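/- Let $m,n$ be integers with $2 \le n \le m/2$, let $\mathcal X$ be a set with $m$ elements, and let $F$ be a field. Let $W_{2,n}^{1}(m)$ be the $\binom m2\times\binom mn$ matrix over $F$ whose rows are indexed by the $2$-subsets of $\mathcal X$ and whose columns are indexed by the $n$-subsets of $\mathcal X$, the entry in row $S$ and column $T$ being $1$ if $|S\cap T|=1$ and $0$ otherwise. Then the rank of $W_{2,n}^{1}(m)$ over $F$ is as follows. 1. If $\operatorname{char} F=0$ and $2n<m$, the rank is $m(m-1)/2$. 2. If $\operatorname{char} F=0$ and $2n=m$, the rank is $(m-1)(m-2)/2$. 3. If $\operatorname{char} F=2$ and $m$ is odd, the rank is $m-1$. 4. If $\operatorname{char} F=2$, $m$ is even and $n$ is even, the rank is $m-2$. 5. If $\operatorname{char} F=2$, $m$ is even and $n$ is odd, the rank is $m-1$. 6. If $\operatorname{char} F=p>2$, $p\nmid m-2n$ and $p\nmid n(m-n)$, the rank is $m(m-1)/2$. 7. If $\operatorname{char} F=p>2$, $p\nmid m-2n$ and $p\mid n(m-n)$, the rank is $(m+1)(m-2)/2$. 8. If $\operatorname{char} F=p>2$, $p\mid m-2n$ and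 $p\mid m$, the rank is $m(m-3)/2$. 9. If $\operatorname{char} F=p>2$, $p\mid m-2n$ and $p\nmid m$, the rank is $(m-1)(m-2)/2$. -/

import Mathlib

/-- The subset-intersection matrix `W_{k,n}^i(m)` of a finite set `X` (where `m = |X|`), with
entries in `F`: the rows are indexed by the `k`-subsets of `X`, the columns by the `n`-subsets
of `X`, and the entry in row `S` and column `T` is `1` if `|S ∩ T| = i` and `0` otherwise. -/
def intersectionMatrix (F : Type*) [Zero F] [One F] (X : Type*) [DecidableEq X] (k n i : ℕ) :
    Matrix {S : Finset X // S.card = k} {T : Finset X // T.card = n} F :=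
  Matrix.of fun S T => if (S.1 ∩ T.1).card = i then 1 else 0

/-!
View a vector indexed by the `2`-subsets of `X` as an edge weight `w` on the complete graph. The
transpose of the intersection matrix sends `w` to the function `T ↦ c(T)`, the total weight of the
edges leaving the `n`-subset `T` (`transpose_mulVec_eq_cut`). Write `m` for the size of `X`.

If `2` is invertible, the rank is `m(m-1)/2` minus the dimension of the space of weights all of
whose cuts vanish. Combining the cuts at four `n`-subsets that differ in two points gives the
four-cycle relation `w(ax) + w(by) = w(ay) + w(bx)` (`four_cycle_of_cut_eq_zero`), which forces
`w(xy) = u(x) + u(y)` for a unique function `u` on `X` (`exists_sumOnSubsets_eq_of_four_cycle`,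
`sumOnSubsets_two_injective`). For such a weight `c(T) = (m - 2n) u(T) + n u(X)`. If `m - 2n` is
not zero in `F`, vanishing of the cuts makes `u` constant, and a nonzero constant is allowed exactly
if `n(m - n) = 0`. If `m - 2n = 0`, the only condition is `n u(X) = 0`. This leaves kernels of
dimension `0`, `1`, `m` and `m - 1`.

In characteristic two, `c(T)` is the sum over `T` of the vertex degrees of `w`
(`transpose_mulVecLin_eq_comp`). The degree sequences are exactly the functions on `X` with sum zero
(`range_weightedDegree`), a space of dimension `m - 1`. A degree sequence with sum zero over every
`n`-subset is constant, and nonzero constants occur among them exactly if both `m` and `n` are even,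
so the rank is `m - 2` in that case and `m - 1` otherwise.
-/

open Finset Module

/-! ### Sums of a function over subsets -/

section SubsetSums

variable {F : Type*} [Field F] {X : Type*} [Fintype X]

/-- The linear functional summing the values of a function on a finite type. -/
def totalSum (F : Type*) [Field F] (X : Type*) [Fintype X] : (X → F) →ₗ[F] F where
  toFun v := ∑ x, v x
  map_add' v w := by simp [sum_add_distrib]
  map_smul' c v := by simp [mul_sum]

/-- The linear map sending a function `v` on `X` to the function `T ↦ ∑ x ∈ T, v x` on the
`k`-subsets of `X`. -/
def sumOnSubsets (F : Type*) [Field F] (X : Type*) (k : ℕ) :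
    (X → F) →ₗ[F] ({T : Finset X // T.card = k} → F) where
  toFun v T := ∑ x ∈ T.1, v x
  map_add' v w := by ext T; simp [sum_add_distrib]
  map_smul' c v := by ext T; simp [mul_sum]

theorem finrank_ker_totalSum [Nonempty X] :
    finrank F (LinearMap.ker (totalSum F X)) + 1 = Fintype.card X := by
  classical
  have hs : LinearMap.range (totalSum F X) = ⊤ := by
    rw [LinearMap.range_eq_top]
    intro c
    refine ⟨Pi.single (Classical.arbitrary X) c, ?_⟩
    simp [totalSum]
  have h := LinearMap.finrank_range_add_finrank_ker (totalSum F X)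
  rw [hs, finrank_top, finrank_self, finrank_fintype_fun_eq_card] at h
  omega

/-- A finite set avoiding finitely many points, of any size that still fits. -/
theorem exists_card_eq_disjoint [DecidableEq X] (B : Finset X) (k : ℕ)
    (h : k + B.card ≤ Fintype.card X) : ∃ A : Finset X, A.card = k ∧ Disjoint A B := by
  have hc : k ≤ (Bᶜ).card := by rw [card_compl]; omega
  obtain ⟨A, hA, hk⟩ := exists_subset_card_eq hc
  exact ⟨A, hk, disjoint_left.2 fun x hx => mem_compl.1 (hA hx)⟩

/-- Exchanging one point of an `n`-subset for another shows that a function whose sums over the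
`n`-subsets all agree is constant. -/
theorem eq_of_forall_sum_eq {n : ℕ} (hn : 1 ≤ n) (hm : n < Fintype.card X) {v : X → F} {c : F}
    (h : ∀ T : Finset X, T.card = n → ∑ x ∈ T, v x = c) (a b : X) : v a = v b := by
  classical
  by_cases hab : a = b
  · rw [hab]
  obtain ⟨A, hA, hd⟩ := exists_card_eq_disjoint {a, b} (n - 1) (by rw [card_pair hab]; omega)
  simp only [disjoint_insert_right, disjoint_singleton_right] at hd
  have h1 := h (insert a A) (by rw [card_insert_of_notMem hd.1]; omega)
  have h2 := h (insert b A) (by rw [card_insert_of_notMem hd.2]; omega)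
  rw [sum_insert hd.1] at h1
  rw [sum_insert hd.2, ← h1] at h2
  exact (add_right_cancel h2).symm

end SubsetSums

/-! ### Cuts of weights on pairs -/

section Cuts

variable {F : Type*} [Field F] {X : Type*} [DecidableEq X]

/-- The symmetric function on `X × X`, zero on the diagonal, that represents a weight on the
`2`-subsets of `X`. -/
def pairWeight (w : {S : Finset X // S.card = 2} → F) (x y : X) : F :=
  if h : x ≠ y then w ⟨{x, y}, card_pair h⟩ else 0

theorem pairWeight_self (w : {S : Finset X // S.card = 2} → F) (x : X) :
    pairWeight w x x = 0 := by simp [pairWeight]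

theorem pairWeight_comm (w : {S : Finset X // S.card = 2} → F) (x y : X) :
    pairWeight w x y = pairWeight w y x := by
  simp only [pairWeight, ne_comm, pair_comm]

theorem pairWeight_sumOnSubsets (u : X → F) {x y : X} (h : x ≠ y) :
    pairWeight (sumOnSubsets F X 2 u) x y = u x + u y := by
  simp [pairWeight, h, sumOnSubsets, sum_pair h]

variable [Fintype X]

/-- The transpose of the intersection matrix sends a weight on pairs to its cut function: the
value at `T` is the total weight of the pairs with one point in `T` and one outside. -/
theorem transpose_mulVec_eq_cut {n : ℕ} (w : {S : Finset X // S.card = 2} → F)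
    (T : {T : Finset X // T.card = n}) :
    (intersectionMatrix F X 2 n 1).transpose.mulVecLin w T =
      ∑ x ∈ T.1, ∑ y ∈ T.1ᶜ, pairWeight w x y := by
  have h0 : (intersectionMatrix F X 2 n 1).transpose.mulVecLin w T =
      ∑ S : {S : Finset X // S.card = 2} with (S.1 ∩ T.1).card = 1, w S := by
    simp only [Matrix.mulVecLin_apply, Matrix.mulVec, dotProduct, Matrix.transpose_apply,
      intersectionMatrix, Matrix.of_apply, ite_mul, one_mul, zero_mul, sum_filter]
  rw [h0, ← sum_product']
  symm
  have hne : ∀ q ∈ T.1 ×ˢ T.1ᶜ, q.1 ≠ q.2 := by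
    intro q hq h
    rw [mem_product, mem_compl, ← h] at hq
    exact hq.2 hq.1
  refine sum_bij (fun q hq => ⟨{q.1, q.2}, card_pair (hne q hq)⟩) ?_ ?_ ?_ ?_
  · intro q hq
    rw [mem_product, mem_compl] at hq
    simp [insert_inter_of_mem hq.1, singleton_inter_of_notMem hq.2]
  · rintro ⟨a, b⟩ hq ⟨c, d⟩ hr h
    simp only [mem_product, mem_compl] at hq hr
    have h' : ({a, b} : Finset X) = {c, d} := congrArg Subtype.val h
    have ha : a ∈ ({c, d} : Finset X) := h' ▸ mem_insert_self a {b}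
    have hb : b ∈ ({c, d} : Finset X) := h' ▸ mem_insert_of_mem (mem_singleton_self b)
    simp only [mem_insert, mem_singleton] at ha hb
    grind
  · rintro ⟨S, hS⟩ hST
    obtain ⟨x, y, hxy, rfl⟩ := card_eq_two.1 hS
    simp only [mem_filter, mem_univ, true_and] at hST
    by_cases hx : x ∈ T.1 <;> by_cases hy : y ∈ T.1
    · rw [insert_inter_of_mem hx, singleton_inter_of_mem hy, card_pair hxy] at hST
      omega
    · exact ⟨(x, y), by simp [hx, hy], rfl⟩
    · exact ⟨(y, x), by simp [hx, hy], by simp [pair_comm]⟩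
    · rw [insert_inter_of_notMem hx, singleton_inter_of_notMem hy] at hST
      simp at hST
  · intro q hq
    simp [pairWeight, hne q hq]

theorem cut_eq_degree_sub (w : {S : Finset X // S.card = 2} → F) (T : Finset X) :
    ∑ x ∈ T, ∑ y ∈ Tᶜ, pairWeight w x y =
      ∑ x ∈ T, ∑ y, pairWeight w x y - ∑ x ∈ T, ∑ y ∈ T, pairWeight w x y := by
  rw [← sum_sub_distrib]
  refine sum_congr rfl fun x _ => ?_
  rw [← sum_add_sum_compl T (pairWeight w x)]
  ring

/-- How a cut changes when `a` moves into `A`: the pairs at `a` are gained, except that those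
joining `a` to `A` were counted before and are lost. -/
theorem cut_insert (w : {S : Finset X // S.card = 2} → F) {A : Finset X} {a : X} (ha : a ∉ A) :
    ∑ x ∈ insert a A, ∑ y ∈ (insert a A)ᶜ, pairWeight w x y =
      ∑ x ∈ A, ∑ y ∈ Aᶜ, pairWeight w x y + ∑ y, pairWeight w a y
        - 2 * ∑ x ∈ A, pairWeight w a x := by
  have hs : ∑ x ∈ A, pairWeight w x a = ∑ x ∈ A, pairWeight w a x :=
    sum_congr rfl fun x _ => pairWeight_comm w x a
  rw [cut_eq_degree_sub, cut_eq_degree_sub]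
  simp only [sum_insert ha, sum_add_distrib, pairWeight_self, hs]
  ring

/-- A weight with vanishing cuts at all `n`-subsets satisfies the four-cycle relation: the
alternating sum of the cuts at `A ∪ {x, a}`, `A ∪ {x, b}`, `A ∪ {y, a}`, `A ∪ {y, b}` leaves only
the weights of the pairs between `{x, y}` and `{a, b}`, each taken twice. -/
theorem four_cycle_of_cut_eq_zero {n : ℕ} (hn : 2 ≤ n) (hm : n + 2 ≤ Fintype.card X)
    (h2 : (2 : F) ≠ 0) {w : {S : Finset X // S.card = 2} → F}
    (h : ∀ T : Finset X, T.card = n → ∑ x ∈ T, ∑ y ∈ Tᶜ, pairWeight w x y = 0)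
    {a b x y : X} (hab : a ≠ b) (hax : a ≠ x) (hay : a ≠ y) (hbx : b ≠ x) (hby : b ≠ y)
    (hxy : x ≠ y) :
    pairWeight w a x + pairWeight w b y = pairWeight w a y + pairWeight w b x := by
  have h4 : ({a, b, x, y} : Finset X).card = 4 := by
    rw [card_insert_of_notMem (by simp [hab, hax, hay]),
      card_insert_of_notMem (by simp [hbx, hby]), card_pair hxy]
  obtain ⟨A, hA, hd⟩ := exists_card_eq_disjoint {a, b, x, y} (n - 2) (by omega)
  simp only [disjoint_insert_right, disjoint_singleton_right] at hd
  obtain ⟨ha, hb, hx, hy⟩ := hd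
  have key : ∀ c z : X, c ∉ A → z ∉ A → c ≠ z →
      ∑ p ∈ A, ∑ q ∈ Aᶜ, pairWeight w p q + ∑ q, pairWeight w z q
        - 2 * ∑ p ∈ A, pairWeight w z p + ∑ q, pairWeight w c q
        - 2 * (pairWeight w c z + ∑ p ∈ A, pairWeight w c p) = 0 := by
    intro c z hc hz hcz
    have hc' : c ∉ insert z A := by simp [hc, hcz]
    have := h (insert c (insert z A)) (by
      rw [card_insert_of_notMem hc', card_insert_of_notMem hz]; omega)
    rwa [cut_insert w hc', cut_insert w hz, sum_insert hz] at this
  have e1 := key a x ha hx hax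
  have e2 := key a y ha hy hay
  have e3 := key b x hb hx hbx
  have e4 := key b y hb hy hby
  apply mul_left_cancel₀ h2
  linear_combination e2 + e3 - e1 - e4

/-- A weight on pairs satisfying the four-cycle relation has the form `{x, y} ↦ u x + u y`. -/
theorem exists_sumOnSubsets_eq_of_four_cycle (hm : 3 ≤ Fintype.card X) (h2 : (2 : F) ≠ 0)
    {w : {S : Finset X // S.card = 2} → F}
    (h : ∀ a b x y : X, a ≠ b → a ≠ x → a ≠ y → b ≠ x → b ≠ y → x ≠ y →
      pairWeight w a x + pairWeight w b y = pairWeight w a y + pairWeight w b x) :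
    ∃ u : X → F, sumOnSubsets F X 2 u = w := by
  obtain ⟨o, y, z, hoy, hoz, hyz⟩ := Fintype.two_lt_card_iff.1 hm
  -- In a weight of the required form, `g a b` is twice the value of `u` at the base point `o`.
  let g : X → X → F := fun a b => pairWeight w o a + pairWeight w o b - pairWeight w a b
  have hg : ∀ a b c, a ≠ o → b ≠ o → c ≠ o → a ≠ b → a ≠ c → g a b = g a c := by
    intro a b c ha hb hc hab hac
    by_cases hbc : b = c
    · rw [hbc]
    have := h o a b c ha.symm hb.symm hc.symm hab hac hbc
    simp only [g]
    linear_combination this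
  have hgs : ∀ a b, g a b = g b a := by
    intro a b
    simp only [g, pairWeight_comm w a b]
    ring
  have hgc : ∀ a b, a ≠ o → b ≠ o → a ≠ b → g a b = g y z := by
    intro a b ha hb hab
    by_cases hay : a = y
    · subst hay
      exact hg _ _ _ ha hb hoz.symm hab hyz
    · rw [hg a b y ha hb hoy.symm hab hay, hgs]
      exact hg _ _ _ hoy.symm ha hoz.symm (Ne.symm hay) hyz
  let u : X → F := fun x => if x = o then g y z / 2 else pairWeight w o x - g y z / 2
  refine ⟨u, funext fun ⟨S, hS⟩ => ?_⟩
  obtain ⟨a, b, hab, rfl⟩ := card_eq_two.1 hS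
  have e : w ⟨{a, b}, hS⟩ = pairWeight w a b := by simp [pairWeight, hab]
  rw [e]
  simp only [sumOnSubsets, LinearMap.coe_mk, AddHom.coe_mk, sum_pair hab]
  by_cases ha : a = o
  · subst ha
    simp [u, hab.symm]
  · by_cases hb : b = o
    · subst hb
      simp [u, ha, pairWeight_comm w b a]
    · have := hgc a b ha hb hab
      simp only [u, ha, hb, if_false]
      simp only [g] at this ⊢
      field_simp
      linear_combination 2 * this

/-- The value `u x` is recovered from the sums over the pairs of a triangle at `x`:
`2 u x = (u x + u y) + (u x + u z) - (u y + u z)`. -/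
theorem sumOnSubsets_two_injective (hm : 3 ≤ Fintype.card X) (h2 : (2 : F) ≠ 0) :
    Function.Injective (sumOnSubsets F X 2) := by
  rw [← LinearMap.ker_eq_bot, LinearMap.ker_eq_bot']
  intro u hu
  have hp : ∀ x y, x ≠ y → u x + u y = 0 := by
    intro x y h
    have := congrFun hu ⟨{x, y}, card_pair h⟩
    simpa [sumOnSubsets, sum_pair h] using this
  funext x
  obtain ⟨A, hA, hd⟩ := exists_card_eq_disjoint {x} 2 (by simpa using hm)
  obtain ⟨y, z, hyz, rfl⟩ := card_eq_two.1 hA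
  simp at hd
  apply mul_left_cancel₀ h2
  simp only [Pi.zero_apply]
  linear_combination hp x y (by grind) + hp x z (by grind) - hp y z hyz

/-- The cut of the weight `{x, y} ↦ u x + u y` at `T` is
`∑ x ∈ T, ∑ y ∉ T, (u x + u y) = (m - n) u(T) + n u(Tᶜ)`. -/
theorem cut_sumOnSubsets {n : ℕ} (u : X → F) (T : {T : Finset X // T.card = n}) :
    (intersectionMatrix F X 2 n 1).transpose.mulVecLin (sumOnSubsets F X 2 u) T =
      ((Fintype.card X : F) - 2 * n) * ∑ x ∈ T.1, u x + n * ∑ x, u x := by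
  have hc : ((T.1ᶜ).card : F) = Fintype.card X - n := by
    rw [card_compl, Nat.cast_sub (card_le_univ _), T.2]
  rw [transpose_mulVec_eq_cut, sum_congr rfl fun x hx => sum_congr rfl fun y hy =>
    pairWeight_sumOnSubsets u (fun h : x = y => mem_compl.1 hy (h ▸ hx))]
  simp only [sum_add_distrib, sum_const, nsmul_eq_mul, ← mul_sum, hc, T.2]
  rw [← sum_add_sum_compl T.1 u]
  ring

/-- Outside characteristic two, the left kernel of the intersection matrix consists of the
weights `{x, y} ↦ u x + u y` with `u` in an explicit subspace `K`. -/
theorem finrank_ker_transpose_eq {n : ℕ} (hn : 2 ≤ n) (hm : n + 2 ≤ Fintype.card X)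
    (h2 : (2 : F) ≠ 0) {K : Submodule F (X → F)}
    (hK : ∀ u, u ∈ K ↔ ∀ T : Finset X, T.card = n →
      ((Fintype.card X : F) - 2 * n) * ∑ x ∈ T, u x + n * ∑ x, u x = 0) :
    finrank F (LinearMap.ker (intersectionMatrix F X 2 n 1).transpose.mulVecLin) =
      finrank F K := by
  have hmem : ∀ u, u ∈ K ↔
      sumOnSubsets F X 2 u ∈ LinearMap.ker (intersectionMatrix F X 2 n 1).transpose.mulVecLin := by
    intro u
    rw [hK, LinearMap.mem_ker, funext_iff]
    simp only [cut_sumOnSubsets, Subtype.forall, Pi.zero_apply]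
  have hmap : K.map (sumOnSubsets F X 2) =
      LinearMap.ker (intersectionMatrix F X 2 n 1).transpose.mulVecLin := by
    ext w
    constructor
    · rintro ⟨u, hu, rfl⟩
      exact (hmem u).1 hu
    · intro hw
      have hw' : ∀ T : Finset X, T.card = n → ∑ x ∈ T, ∑ y ∈ Tᶜ, pairWeight w x y = 0 := by
        intro T hT
        rw [← transpose_mulVec_eq_cut w ⟨T, hT⟩, LinearMap.mem_ker.1 hw]
        rfl
      obtain ⟨u, rfl⟩ := exists_sumOnSubsets_eq_of_four_cycle (by omega) h2
        fun a b x y hab hax hay hbx hby hxy =>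
          four_cycle_of_cut_eq_zero hn hm h2 hw' hab hax hay hbx hby hxy
      exact ⟨u, (hmem u).2 hw, rfl⟩
  rw [← hmap]
  exact (Submodule.equivMapOfInjective _
    (sumOnSubsets_two_injective (by omega) h2) K).finrank_eq.symm

theorem rank_add_finrank_ker_transpose (n : ℕ) :
    (intersectionMatrix F X 2 n 1).rank +
      finrank F (LinearMap.ker (intersectionMatrix F X 2 n 1).transpose.mulVecLin) =
        (Fintype.card X).choose 2 := by
  rw [← Matrix.rank_transpose, Matrix.rank, LinearMap.finrank_range_add_finrank_ker,
    finrank_fintype_fun_eq_card, Fintype.card_finset_len]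

end Cuts

/-! ### The left kernel when two is invertible -/

section OddCharacteristic

variable {F : Type*} [Field F] {X : Type*} [Fintype X] {n : ℕ}

theorem eq_of_forall_combination_eq_zero (hn : 2 ≤ n) (hm : n + 2 ≤ Fintype.card X)
    (hd : (Fintype.card X : F) - 2 * n ≠ 0) {u : X → F}
    (h : ∀ T : Finset X, T.card = n →
      ((Fintype.card X : F) - 2 * n) * ∑ x ∈ T, u x + n * ∑ x, u x = 0) (a b : X) :
    u a = u b := by
  refine eq_of_forall_sum_eq (n := n) (by omega) (by omega)
    (c := -(n * ∑ x, u x) / ((Fintype.card X : F) - 2 * n)) (fun T hT => ?_) a b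
  rw [eq_div_iff hd]
  linear_combination h T hT

variable [DecidableEq X]

theorem finrank_ker_of_ne_of_ne (hn : 2 ≤ n) (hm : n + 2 ≤ Fintype.card X) (h2 : (2 : F) ≠ 0)
    (hd : (Fintype.card X : F) - 2 * n ≠ 0) (hq : (n : F) * (Fintype.card X - n) ≠ 0) :
    finrank F (LinearMap.ker (intersectionMatrix F X 2 n 1).transpose.mulVecLin) = 0 := by
  rw [finrank_ker_transpose_eq hn hm h2 (K := ⊥), finrank_bot]
  intro u
  rw [Submodule.mem_bot]
  refine ⟨?_, fun h => ?_⟩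
  · rintro rfl
    simp
  · funext a
    have hu : u = fun _ => u a := funext fun b => eq_of_forall_combination_eq_zero hn hm hd h b a
    obtain ⟨T, hT, -⟩ := exists_card_eq_disjoint (∅ : Finset X) n (by simp; omega)
    -- For a constant function the condition at `T` reads `2 n (m - n) u = 0`.
    have := h T hT
    rw [hu] at this
    simp only [sum_const, nsmul_eq_mul, hT, card_univ] at this
    refine (mul_eq_zero.1 (?_ : 2 * ((n : F) * (Fintype.card X - n)) * u a = 0)).resolve_left
      (mul_ne_zero h2 hq)
    linear_combination this

theorem finrank_ker_of_ne_of_eq (hn : 2 ≤ n) (hm : n + 2 ≤ Fintype.card X) (h2 : (2 : F) ≠ 0)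
    (hd : (Fintype.card X : F) - 2 * n ≠ 0) (hq : (n : F) * (Fintype.card X - n) = 0) :
    finrank F (LinearMap.ker (intersectionMatrix F X 2 n 1).transpose.mulVecLin) = 1 := by
  have : Nonempty X := Fintype.card_pos_iff.1 (by omega)
  rw [finrank_ker_transpose_eq hn hm h2 (K := Submodule.span F {1}),
    finrank_span_singleton one_ne_zero]
  intro u
  rw [Submodule.mem_span_singleton]
  constructor
  · rintro ⟨c, rfl⟩ T hT
    simp only [Pi.smul_apply, Pi.one_apply, smul_eq_mul, mul_one, sum_const, nsmul_eq_mul, hT,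
      card_univ]
    linear_combination 2 * c * hq
  · intro h
    refine ⟨u (Classical.arbitrary X), funext fun b => ?_⟩
    simpa using eq_of_forall_combination_eq_zero hn hm hd h _ b

theorem finrank_ker_of_eq_of_eq (hn : 2 ≤ n) (hm : n + 2 ≤ Fintype.card X) (h2 : (2 : F) ≠ 0)
    (hd : (Fintype.card X : F) - 2 * n = 0) (hq : (n : F) = 0) :
    finrank F (LinearMap.ker (intersectionMatrix F X 2 n 1).transpose.mulVecLin) =
      Fintype.card X := by
  rw [finrank_ker_transpose_eq hn hm h2 (K := ⊤), finrank_top, finrank_fintype_fun_eq_card]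
  intro u
  exact ⟨fun _ T _ => by rw [hd, hq, zero_mul, zero_mul, add_zero], fun _ => Submodule.mem_top⟩

theorem finrank_ker_of_eq_of_ne (hn : 2 ≤ n) (hm : n + 2 ≤ Fintype.card X) (h2 : (2 : F) ≠ 0)
    (hd : (Fintype.card X : F) - 2 * n = 0) (hq : (n : F) ≠ 0) :
    finrank F (LinearMap.ker (intersectionMatrix F X 2 n 1).transpose.mulVecLin) + 1 =
      Fintype.card X := by
  have : Nonempty X := Fintype.card_pos_iff.1 (by omega)
  rw [finrank_ker_transpose_eq hn hm h2 (K := LinearMap.ker (totalSum F X)),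
    finrank_ker_totalSum]
  intro u
  obtain ⟨T, hT, -⟩ := exists_card_eq_disjoint (∅ : Finset X) n (by simp; omega)
  simp only [hd, zero_mul, zero_add, mul_eq_zero, hq, false_or, LinearMap.mem_ker]
  exact ⟨fun h _ _ => h, fun h => h T hT⟩

end OddCharacteristic

/-! ### The rank in characteristic two -/

section CharacteristicTwo

variable {F : Type*} [Field F] {X : Type*} [Fintype X]

theorem finrank_ker_inf_ker_of_eq_zero {n : ℕ} (hn : 2 ≤ n) (hm : n + 2 ≤ Fintype.card X)
    (hX : (Fintype.card X : F) = 0) (h : (n : F) = 0) :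
    finrank F ↥(LinearMap.ker (totalSum F X) ⊓ LinearMap.ker (sumOnSubsets F X n)) = 1 := by
  have : Nonempty X := Fintype.card_pos_iff.1 (by omega)
  have hs : LinearMap.ker (totalSum F X) ⊓ LinearMap.ker (sumOnSubsets F X n) =
      Submodule.span F {1} := by
    ext u
    rw [Submodule.mem_span_singleton]
    constructor
    · rintro ⟨-, hu⟩
      refine ⟨u (Classical.arbitrary X), funext fun b => ?_⟩
      simpa using eq_of_forall_sum_eq (n := n) (by omega) (by omega)
        (fun T hT => congrFun (LinearMap.mem_ker.1 hu) ⟨T, hT⟩) _ b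
    · rintro ⟨c, rfl⟩
      refine ⟨?_, funext fun T => ?_⟩
      · simp [totalSum, hX]
      · simp [sumOnSubsets, T.2, h]
  rw [hs, finrank_span_singleton one_ne_zero]

theorem finrank_ker_inf_ker_of_ne_zero {n : ℕ} (hn : 2 ≤ n) (hm : n + 2 ≤ Fintype.card X)
    (h : (Fintype.card X : F) ≠ 0 ∨ (n : F) ≠ 0) :
    finrank F ↥(LinearMap.ker (totalSum F X) ⊓ LinearMap.ker (sumOnSubsets F X n)) = 0 := by
  classical
  have hs : LinearMap.ker (totalSum F X) ⊓ LinearMap.ker (sumOnSubsets F X n) = ⊥ := by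
    rw [Submodule.eq_bot_iff]
    rintro u ⟨h1, h2⟩
    have hT : ∀ T : Finset X, T.card = n → ∑ x ∈ T, u x = 0 :=
      fun T hT => congrFun (LinearMap.mem_ker.1 h2) ⟨T, hT⟩
    funext a
    have hu : u = fun _ => u a :=
      funext fun b => eq_of_forall_sum_eq (n := n) (by omega) (by omega) hT b a
    rcases h with h | h
    · have h0 : ∑ x, u x = 0 := h1
      rw [hu, sum_const, nsmul_eq_mul, card_univ] at h0
      exact (mul_eq_zero.1 h0).resolve_left h
    · obtain ⟨T, hTn, -⟩ := exists_card_eq_disjoint (∅ : Finset X) n (by simp; omega)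
      have h0 := hT T hTn
      rw [hu, sum_const, nsmul_eq_mul, hTn] at h0
      exact (mul_eq_zero.1 h0).resolve_left h
  rw [hs, finrank_bot]

variable [DecidableEq X]

/-- The vertex degrees of a weight on the `2`-subsets of `X`, seen as a weighted graph. -/
def weightedDegree (F : Type*) [Field F] (X : Type*) [Fintype X] [DecidableEq X] :
    ({S : Finset X // S.card = 2} → F) →ₗ[F] (X → F) where
  toFun w x := ∑ S : {S : Finset X // S.card = 2}, if x ∈ S.1 then w S else 0
  map_add' v w := by
    ext x
    simp only [Pi.add_apply, ← sum_add_distrib]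
    exact sum_congr rfl fun S _ => by split_ifs <;> simp
  map_smul' c v := by
    ext x
    simp [mul_sum]

theorem sum_weightedDegree (w : {S : Finset X // S.card = 2} → F) (T : Finset X) :
    ∑ x ∈ T, weightedDegree F X w x =
      ∑ S : {S : Finset X // S.card = 2}, ((S.1 ∩ T).card : F) * w S := by
  simp only [weightedDegree, LinearMap.coe_mk, AddHom.coe_mk]
  rw [sum_comm]
  refine sum_congr rfl fun S _ => ?_
  rw [← sum_filter, sum_const, nsmul_eq_mul, filter_mem_eq_inter, inter_comm]

/-- In characteristic two a pair meeting `T` in two points contributes twice to the degree sum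
over `T`, hence not at all, so that the cut at `T` is the degree sum over `T`. -/
theorem transpose_mulVecLin_eq_comp (n : ℕ) (h2 : (2 : F) = 0) :
    (intersectionMatrix F X 2 n 1).transpose.mulVecLin =
      sumOnSubsets F X n ∘ₗ weightedDegree F X := by
  refine LinearMap.ext fun w => funext fun T => ?_
  change _ = ∑ x ∈ T.1, weightedDegree F X w x
  rw [sum_weightedDegree, Matrix.mulVecLin_apply]
  simp only [Matrix.mulVec, dotProduct, Matrix.transpose_apply, intersectionMatrix,
    Matrix.of_apply]
  refine sum_congr rfl fun S _ => ?_
  congr 1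
  have hle : (S.1 ∩ T.1).card ≤ 2 := (card_le_card inter_subset_left).trans S.2.le
  interval_cases (S.1 ∩ T.1).card <;> simp [h2]

/-- In characteristic two the degree sequences are the functions with sum zero; a star realises
each of them. -/
theorem range_weightedDegree [Nonempty X] (h2 : (2 : F) = 0) :
    LinearMap.range (weightedDegree F X) = LinearMap.ker (totalSum F X) := by
  have hsum : ∀ w, ∑ x, weightedDegree F X w x = 0 := by
    intro w
    rw [sum_weightedDegree]
    refine sum_eq_zero fun S _ => ?_
    rw [inter_univ, S.2, Nat.cast_ofNat, h2, zero_mul]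
  ext v
  rw [LinearMap.mem_ker]
  constructor
  · rintro ⟨w, rfl⟩
    exact hsum w
  · intro hv
    change ∑ x, v x = 0 at hv
    let o := Classical.arbitrary X
    have key : ∀ x, x ≠ o →
        weightedDegree F X (fun S => if o ∈ S.1 then ∑ y ∈ S.1.erase o, v y else 0) x = v x := by
      intro x hx
      simp only [weightedDegree, LinearMap.coe_mk, AddHom.coe_mk]
      rw [sum_eq_single ⟨{o, x}, card_pair hx.symm⟩]
      · simp [hx.symm]
      · rintro ⟨S, hS⟩ - hne
        obtain ⟨a, b, hab, rfl⟩ := card_eq_two.1 hS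
        simp only [mem_insert, mem_singleton, ne_eq, Subtype.mk.injEq] at hne ⊢
        split_ifs with h1 h3
        · exact absurd (by ext z; simp only [mem_insert, mem_singleton]; grind) hne
        · rfl
        · rfl
      · simp
    refine ⟨fun S => if o ∈ S.1 then ∑ y ∈ S.1.erase o, v y else 0, funext fun x => ?_⟩
    by_cases hx : x = o
    · -- Both functions have sum zero, so agreeing off `o` they agree at `o`.
      have hd : ∑ x, weightedDegree F X
          (fun S => if o ∈ S.1 then ∑ y ∈ S.1.erase o, v y else 0) x = 0 := hsum _
      rw [← add_sum_erase univ _ (mem_univ o),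
        sum_congr rfl fun y hy => key y (ne_of_mem_erase hy)] at hd
      rw [← add_sum_erase univ v (mem_univ o), ← hd] at hv
      rw [hx]
      exact (add_right_cancel hv).symm
    · exact key x hx

/-- The rank in characteristic two: the degree sequences form a space of dimension `m - 1`, and the
rank falls short of it by those degree sequences that have sum zero over every `n`-subset. -/
theorem rank_add_finrank_of_two_eq_zero [Nonempty X] (n : ℕ) (h2 : (2 : F) = 0) :
    (intersectionMatrix F X 2 n 1).rank +
      finrank F ↥(LinearMap.ker (totalSum F X) ⊓ LinearMap.ker (sumOnSubsets F X n)) + 1 =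
        Fintype.card X := by
  have h := LinearMap.finrank_range_add_finrank_ker
    ((sumOnSubsets F X n).domRestrict (LinearMap.ker (totalSum F X)))
  rw [← Matrix.rank_transpose, Matrix.rank, transpose_mulVecLin_eq_comp n h2,
    LinearMap.range_comp, range_weightedDegree h2, ← finrank_ker_totalSum (F := F) (X := X), ← h,
    LinearMap.range_domRestrict, LinearMap.ker_domRestrict]
  rw [← Submodule.map_comap_subtype, Submodule.finrank_map_subtype_eq, add_assoc]

end CharacteristicTwo

/-! ### The rank formulas -/

theorem mainTheorem1 {F : Type*} [Field F] (p : ℕ) [CharP F p]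
    {X : Type*} [Fintype X] [DecidableEq X] (m n : ℕ) (hX : Fintype.card X = m)
    (hn : 2 ≤ n) (hnm : 2 * n ≤ m) :
    (p = 0 → 2 * n < m →
      ((intersectionMatrix F X 2 n 1).rank : ℚ) = (m : ℚ) * ((m : ℚ) - 1) / 2) ∧
    (p = 0 → 2 * n = m →
      ((intersectionMatrix F X 2 n 1).rank : ℚ) = ((m : ℚ) - 1) * ((m : ℚ) - 2) / 2) ∧
    (p = 2 → Odd m →
      ((intersectionMatrix F X 2 n 1).rank : ℚ) = (m : ℚ) - 1) ∧
    (p = 2 → Even m → Even n →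
      ((intersectionMatrix F X 2 n 1).rank : ℚ) = (m : ℚ) - 2) ∧
    (p = 2 → Even m → Odd n →
      ((intersectionMatrix F X 2 n 1).rank : ℚ) = (m : ℚ) - 1) ∧
    (2 < p → ¬ (p : ℤ) ∣ (m : ℤ) - 2 * (n : ℤ) → ¬ (p : ℤ) ∣ (n : ℤ) * ((m : ℤ) - (n : ℤ)) →
      ((intersectionMatrix F X 2 n 1).rank : ℚ) = (m : ℚ) * ((m : ℚ) - 1) / 2) ∧
    (2 < p → ¬ (p : ℤ) ∣ (m : ℤ) - 2 * (n : ℤ) → (p : ℤ) ∣ (n : ℤ) * ((m : ℤ) - (n : ℤ)) →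
      ((intersectionMatrix F X 2 n 1).rank : ℚ) = ((m : ℚ) + 1) * ((m : ℚ) - 2) / 2) ∧
    (2 < p → (p : ℤ) ∣ (m : ℤ) - 2 * (n : ℤ) → (p : ℤ) ∣ (m : ℤ) →
      ((intersectionMatrix F X 2 n 1).rank : ℚ) = (m : ℚ) * ((m : ℚ) - 3) / 2) ∧
    (2 < p → (p : ℤ) ∣ (m : ℤ) - 2 * (n : ℤ) → ¬ (p : ℤ) ∣ (m : ℤ) →
      ((intersectionMatrix F X 2 n 1).rank : ℚ) = ((m : ℚ) - 1) * ((m : ℚ) - 2) / 2) := by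
  subst hX
  have hm : n + 2 ≤ Fintype.card X := by omega
  have : Nonempty X := Fintype.card_pos_iff.1 (by omega)
  have hd : (p : ℤ) ∣ (Fintype.card X : ℤ) - 2 * (n : ℤ) ↔
      (Fintype.card X : F) - 2 * n = 0 := by
    rw [← CharP.intCast_eq_zero_iff F p]; push_cast; rfl
  have hq : (p : ℤ) ∣ (n : ℤ) * ((Fintype.card X : ℤ) - (n : ℤ)) ↔
      (n : F) * (Fintype.card X - n) = 0 := by
    rw [← CharP.intCast_eq_zero_iff F p]; push_cast; rfl
  have hm0 : (p : ℤ) ∣ (Fintype.card X : ℤ) ↔ (Fintype.card X : F) = 0 := by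
    rw [← CharP.intCast_eq_zero_iff F p]; push_cast; rfl
  have h2 : p ≠ 2 → (2 : F) ≠ 0 := by
    intro hp h
    have hdvd : p ∣ 2 := (CharP.cast_eq_zero_iff F p 2).1 (by exact_mod_cast h)
    rcases (Nat.dvd_prime Nat.prime_two).1 hdvd with h1 | h1
    · exact CharP.char_ne_one F p h1
    · exact hp h1
  have h2' : p = 2 → (2 : F) = 0 := by
    rintro rfl
    exact_mod_cast CharP.cast_eq_zero F 2
  -- Outside characteristic two, the rank is `m(m-1)/2` minus the dimension of the left kernel.
  have hrank := congrArg (Nat.cast (R := ℚ)) (rank_add_finrank_ker_transpose (F := F) (X := X) n)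
  rw [Nat.cast_add, Nat.cast_choose_two] at hrank
  have hrank2 := fun h => congrArg (Nat.cast (R := ℚ))
    (rank_add_finrank_of_two_eq_zero (F := F) (X := X) n h)
  have hnm0 : (n : F) = 0 → (Fintype.card X : F) - 2 * n = 0 → (Fintype.card X : F) = 0 := by
    intro h1 h3
    linear_combination h3 + 2 * h1
  have hmn0 : (2 : F) ≠ 0 → (Fintype.card X : F) = 0 → (Fintype.card X : F) - 2 * n = 0 →
      (n : F) = 0 := by
    intro h1 h3 h4
    apply mul_left_cancel₀ h1
    linear_combination h3 - h4
  refine ⟨?_, ?_, ?_, ?_, ?_, ?_, ?_, ?_, ?_⟩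
  · intro hp hlt
    subst hp
    rw [finrank_ker_of_ne_of_ne hn hm (h2 (by omega))] at hrank
    · push_cast at hrank; linarith
    · rw [ne_eq, ← hd, Nat.cast_zero, zero_dvd_iff]; omega
    · rw [ne_eq, ← hq, Nat.cast_zero, zero_dvd_iff, mul_eq_zero]; omega
  · intro hp heq
    subst hp
    have hk := finrank_ker_of_eq_of_ne (F := F) hn hm (h2 (by omega))
      (by rw [← hd, Nat.cast_zero, zero_dvd_iff]; omega)
      (by rw [ne_eq, CharP.cast_eq_zero_iff F 0, zero_dvd_iff]; omega)
    have hk' := congrArg (Nat.cast (R := ℚ)) hk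
    push_cast at hk'
    linarith
  · intro hp hodd
    have h := hrank2 (h2' hp)
    subst hp
    rw [finrank_ker_inf_ker_of_ne_zero hn hm (Or.inl ?_)] at h
    · push_cast at h; linarith
    · rw [ne_eq, CharP.cast_eq_zero_iff F 2, ← even_iff_two_dvd]
      exact Nat.not_even_iff_odd.2 hodd
  · intro hp hme hne
    have h := hrank2 (h2' hp)
    subst hp
    rw [finrank_ker_inf_ker_of_eq_zero hn hm
      ((CharP.cast_eq_zero_iff F 2 _).2 hme.two_dvd)
      ((CharP.cast_eq_zero_iff F 2 _).2 hne.two_dvd)] at h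
    push_cast at h
    linarith
  · intro hp _ hno
    have h := hrank2 (h2' hp)
    subst hp
    rw [finrank_ker_inf_ker_of_ne_zero hn hm (Or.inr ?_)] at h
    · push_cast at h; linarith
    · rw [ne_eq, CharP.cast_eq_zero_iff F 2, ← even_iff_two_dvd]
      exact Nat.not_even_iff_odd.2 hno
  · intro hp h1 h3
    rw [finrank_ker_of_ne_of_ne hn hm (h2 (by omega)) (mt hd.2 h1) (mt hq.2 h3)] at hrank
    push_cast at hrank
    linarith
  · intro hp h1 h3
    rw [finrank_ker_of_ne_of_eq hn hm (h2 (by omega)) (mt hd.2 h1) (hq.1 h3)] at hrank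
    push_cast at hrank
    linarith
  · intro hp h1 h3
    have hp2 := h2 (by omega)
    rw [finrank_ker_of_eq_of_eq hn hm hp2 (hd.1 h1) (hmn0 hp2 (hm0.1 h3) (hd.1 h1))] at hrank
    linarith
  · intro hp h1 h3
    have hk := finrank_ker_of_eq_of_ne (F := F) hn hm (h2 (by omega)) (hd.1 h1)
      fun h => h3 (hm0.2 (hnm0 h (hd.1 h1)))
    have hk' := congrArg (Nat.cast (R := ℚ)) hk
    push_cast at hk'
    linarith
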